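/- For real $\nu>-1$ and $x>0$ let $J_\nu(x)=\sum_{n\ge 0}\frac{(-1)^n}{n!\,\Gamma(n+\nu+1)}\left(\frac{x}{2}\right)^{2n+\nu}$ be the Bessel function of the first kind, and let $d_\nu(x)=(1-\nu)J_\nu(x)+xJ_\nu'(x)$ be the Dini function. For every $\nu>-1$ the function $d_\nu$ has a smallest positive zero $\alpha_{\nu,1}$, and the following hold, where "increasing" means non-decreasing. (i) For every $x\in(0,\alpha_{\nu,1})$ we have $d_\mu(x)>0$ for all $\mu\ge\nu$, and the functions $$\mu\mapsto 2^{\mu}\Gamma(\mu+1)x^{-\mu}d_\mu(x)\qquad\text{and}\qquad \mu\mapsto\frac{x\,d_\mu'(x)}{d_\mu(x)}$$ are increasing on $[\nu,\infty)$. (ii) For all $\mu\ge\nu$ and $x\in(0,\alpha_{\nu,1})$, $$x^{\nu-\mu}\frac{d_\mu(x)}{d_\nu(x)}\ge 2^{\nu-\mu}\frac{\Gamma(\nu+1)}{\Gamma(\mu+1)}\qquad\text{and}\qquad \frac{d_\mu'(x)}{d_\mu(x)}\ge\frac{d_\nu'(x)}{d_\nu(x)}.$$ (iii) For all $\mu\ge\nu$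 the function $x\mapsto d_\mu(x)/d_\nu(x)$ is increasing on $(0,\alpha_{\nu,1})$. -/

import Mathlib

noncomputable section

/-- The Bessel function of the first kind of real order `ν`, on the positive half-line:
`J_ν(x) = ∑ (-1)^n / (n! Γ(n + ν + 1)) (x/2)^(2n + ν)`.
The value `Real.Gamma = 0` at the poles of `Γ` gives the usual convention `1/Γ = 0` there. -/
def besselJ (ν x : ℝ) : ℝ :=
  ∑' n : ℕ, (-1 : ℝ) ^ n / ((n.factorial : ℝ) * Real.Gamma ((n : ℝ) + ν + 1)) *
    (x / 2) ^ (2 * (n : ℝ) + ν)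

/-- The Dini function `d_ν(x) = (1 - ν) J_ν(x) + x J_ν'(x)`. -/
def dini (ν x : ℝ) : ℝ :=
  (1 - ν) * besselJ ν x + x * deriv (besselJ ν) x

/-- The first positive zero `α_{ν,1}` of the Dini function `d_ν`. -/
def diniZero (ν : ℝ) : ℝ :=
  sInf {x : ℝ | 0 < x ∧ dini ν x = 0}

end

open MeasureTheory Set Filter Topology

noncomputable section

/-! In the variable `t = x² / 4`, and up to an explicit positive factor, `J_ν` becomes `f = ₀F₁(; ν
+ 1; -t)` and `d_ν` becomes `G = f + 2 t f'`; put `H = t G'`.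

Orders are linked by averaging (`besselCoeff_eq_mul_integral`): the Taylor coefficients of order `μ
> ν` are those of order `ν` times the moments of the Beta law with parameters `ν + 1`, `μ - ν`.
Hence `G_μ(t) = E[G_ν(tU)]` and `H_μ(t) = E[H_ν(tU)]` with `0 < U < 1`. As long as `G_ν` stays
positive, both comparisons of orders reduce to two facts about `ν` alone: `G_ν` and `H_ν / G_ν`
decrease in `t`.

Both facts come from `P = -t f' / f`: since `G = f (1 - 2P)`, one has `-H/G = P + 2 t P' / (1 - 2P)`
with `P < 1/2`. It remains that `P` and `t P'` increase, i.e. that `K = f² P'` and `S = f² (t P')'`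
are positive. By the Bessel equation, `t ^ (ν + 1) * K` and `t ^ (ν + 1) * S` vanish at `0` and have
positive derivatives (`besselK_pos`, `besselS_pos`). -/

/-! ### Entire real power series. -/

/-- The sum of the power series with coefficients `a`. -/
def powerSum (a : ℕ → ℝ) (t : ℝ) : ℝ := ∑' n, a n * t ^ n

/-- The power series with coefficients `a` converges absolutely on the whole line. -/
def IsEntire (a : ℕ → ℝ) : Prop := ∀ R : ℝ, 0 ≤ R → Summable fun n => |a n| * R ^ n

/-- The coefficients of the derivative of a power series. -/
def derivCoeff (a : ℕ → ℝ) (n : ℕ) : ℝ := (n + 1) * a (n + 1)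

lemma IsEntire.summable {a : ℕ → ℝ} (ha : IsEntire a) (t : ℝ) :
    Summable fun n => a n * t ^ n := by
  rw [← summable_abs_iff]
  simpa [abs_mul, abs_pow] using ha |t| (abs_nonneg t)

lemma IsEntire.natCast_mul {a : ℕ → ℝ} (ha : IsEntire a) :
    IsEntire fun n => (n : ℝ) * a n := by
  intro R hR
  refine Summable.of_nonneg_of_le (fun n => by positivity) (fun n => ?_)
    (ha (2 * R) (by positivity))
  have h : (n : ℝ) ≤ 2 ^ n := by exact_mod_cast (Nat.lt_two_pow_self).le
  rw [abs_mul, Nat.abs_cast, mul_pow]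
  calc (n : ℝ) * |a n| * R ^ n ≤ 2 ^ n * |a n| * R ^ n := by gcongr
    _ = _ := by ring

lemma IsEntire.add {a b : ℕ → ℝ} (ha : IsEntire a) (hb : IsEntire b) :
    IsEntire fun n => a n + b n := by
  intro R hR
  refine Summable.of_nonneg_of_le (fun n => by positivity) (fun n => ?_)
    ((ha R hR).add (hb R hR))
  rw [← add_mul]
  gcongr
  exact abs_add_le _ _

lemma IsEntire.const_mul {a : ℕ → ℝ} (ha : IsEntire a) (c : ℝ) :
    IsEntire fun n => c * a n := by
  intro R hR
  simpa [abs_mul, mul_assoc] using (ha R hR).mul_left |c|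

lemma IsEntire.comp_succ {a : ℕ → ℝ} (ha : IsEntire a) :
    IsEntire fun n => a (n + 1) := by
  intro R hR
  refine Summable.of_nonneg_of_le (fun n => by positivity) (fun n => ?_)
    ((summable_nat_add_iff 1).2 (ha (R + 1) (by positivity)))
  have h1 : R ^ n ≤ (R + 1) ^ n := pow_le_pow_left₀ hR (by linarith) n
  have h2 : (R + 1) ^ n ≤ (R + 1) ^ (n + 1) := pow_le_pow_right₀ (by linarith) (by omega)
  gcongr
  exact h1.trans h2

lemma IsEntire.derivCoeff {a : ℕ → ℝ} (ha : IsEntire a) : IsEntire (derivCoeff a) := by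
  have h := ha.natCast_mul.comp_succ
  push_cast at h
  exact h

lemma mul_powerSum_derivCoeff {a : ℕ → ℝ} (ha : IsEntire a) (t : ℝ) :
    t * powerSum (derivCoeff a) t = powerSum (fun n => (n : ℝ) * a n) t := by
  rw [powerSum, powerSum, (ha.natCast_mul.summable t).tsum_eq_zero_add, ← tsum_mul_left]
  simp only [CharP.cast_eq_zero, zero_mul, zero_add, derivCoeff]
  exact tsum_congr fun n => by push_cast; ring

lemma powerSum_zero (a : ℕ → ℝ) : powerSum a 0 = a 0 := by
  rw [powerSum, tsum_eq_single 0]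
  · simp
  · intro n hn
    simp [hn]

lemma IsEntire.hasDerivAt {a : ℕ → ℝ} (ha : IsEntire a) (t : ℝ) :
    HasDerivAt (powerSum a) (powerSum (_root_.derivCoeff a) t) t := by
  have key : HasDerivAt (fun z => ∑' n, a n * z ^ n) (∑' n : ℕ, a n * (n * t ^ (n - 1))) t := by
    refine hasDerivAt_tsum_of_isPreconnected (g := fun n z => a n * z ^ n)
      -- A radius at least `1` lets the exponent `n` dominate `n - 1`.
      (g' := fun n z => a n * (n * z ^ (n - 1))) (u := fun n : ℕ => |(n : ℝ) * a n| * (|t| + 1) ^ n)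
      (ha.natCast_mul _ (by positivity)) (t := Metric.ball 0 (|t| + 1)) Metric.isOpen_ball
      (convex_ball 0 _).isPreconnected (fun n y _ => (hasDerivAt_pow n y).const_mul _)
      (fun n y hy => ?_) (y₀ := 0) (Metric.mem_ball_self (by positivity)) (ha.summable 0)
      (mem_ball_zero_iff.2 (by rw [Real.norm_eq_abs]; linarith))
    have hy' : |y| ≤ |t| + 1 := by simpa using (mem_ball_zero_iff.1 hy).le
    have h1 : |y| ^ (n - 1) ≤ (|t| + 1) ^ n :=
      (pow_le_pow_left₀ (abs_nonneg y) hy' _).trans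
        (pow_le_pow_right₀ (by linarith [abs_nonneg t]) (by omega))
    rw [Real.norm_eq_abs, abs_mul, abs_mul, abs_mul, abs_pow, Nat.abs_cast]
    calc |a n| * (n * |y| ^ (n - 1)) ≤ |a n| * (n * (|t| + 1) ^ n) := by gcongr
      _ = _ := by ring
  have hs : Summable fun n : ℕ => a n * (n * t ^ (n - 1)) := by
    rw [← summable_nat_add_iff 1]
    refine (ha.derivCoeff.summable t).congr fun n => ?_
    simp [_root_.derivCoeff]; ring
  have he : ∑' n : ℕ, a n * (n * t ^ (n - 1)) = powerSum (_root_.derivCoeff a) t := by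
    rw [hs.tsum_eq_zero_add, powerSum]
    simp only [CharP.cast_eq_zero, zero_mul, mul_zero, zero_add, _root_.derivCoeff]
    exact tsum_congr fun n => by push_cast; ring
  rw [← he]
  exact key

/-! ### Normalized Bessel and Dini functions. -/

/-- The Taylor coefficients of `₀F₁(; ν + 1; -t)`. -/
def besselCoeff (ν : ℝ) (n : ℕ) : ℝ :=
  (-1) ^ n * Real.Gamma (ν + 1) / (n.factorial * Real.Gamma (n + ν + 1))

lemma besselCoeff_zero {ν : ℝ} (hν : -1 < ν) : besselCoeff ν 0 = 1 := by
  have := Real.Gamma_pos_of_pos (show 0 < ν + 1 by linarith)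
  simp [besselCoeff, this.ne']

lemma besselCoeff_succ {ν : ℝ} (hν : -1 < ν) (n : ℕ) :
    (n + 1) * (n + 1 + ν) * besselCoeff ν (n + 1) = -besselCoeff ν n := by
  have h0 : 0 < (n : ℝ) + ν + 1 := by have := n.cast_nonneg (α := ℝ); linarith
  have hG := (Real.Gamma_pos_of_pos h0).ne'
  have e : ((n + 1 : ℕ) : ℝ) + ν + 1 = (n + ν + 1) + 1 := by push_cast; ring
  rw [besselCoeff, besselCoeff, e, Real.Gamma_add_one h0.ne', Nat.factorial_succ]
  have h2 : (n : ℝ) + 1 + ν ≠ 0 := by linarith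
  have h3 : (n : ℝ) + 1 ≠ 0 := by positivity
  push_cast
  field_simp
  ring

lemma abs_besselCoeff_le {ν : ℝ} (hν : -1 < ν) (n : ℕ) :
    |besselCoeff ν n| ≤ (1 / (ν + 1)) ^ n / n.factorial := by
  have hν' : 0 < ν + 1 := by linarith
  induction n with
  | zero => simp [besselCoeff_zero hν]
  | succ n ih =>
    have hn := n.cast_nonneg (α := ℝ)
    have h := congrArg abs (besselCoeff_succ hν n)
    rw [abs_neg, abs_mul, abs_of_nonneg (by nlinarith)] at h
    have h1 : ((n : ℝ) + 1) * (ν + 1) * |besselCoeff ν (n + 1)| ≤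
        (1 / (ν + 1)) ^ n / n.factorial := by
      refine le_trans ?_ (h.le.trans ih)
      gcongr ?_ * |besselCoeff ν (n + 1)|
      nlinarith
    rw [Nat.factorial_succ, pow_succ]
    push_cast
    calc |besselCoeff ν (n + 1)|
        = ((n : ℝ) + 1) * (ν + 1) * |besselCoeff ν (n + 1)| / ((n + 1) * (ν + 1)) := by
          field_simp
      _ ≤ (1 / (ν + 1)) ^ n / n.factorial / ((n + 1) * (ν + 1)) := by gcongr
      _ = _ := by field_simp

lemma isEntire_besselCoeff {ν : ℝ} (hν : -1 < ν) : IsEntire (besselCoeff ν) := by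
  intro R hR
  have hν' : 0 < ν + 1 := by linarith
  refine Summable.of_nonneg_of_le (fun n => by positivity) (fun n => ?_)
    (Real.summable_pow_div_factorial (1 / (ν + 1) * R))
  calc |besselCoeff ν n| * R ^ n ≤ (1 / (ν + 1)) ^ n / n.factorial * R ^ n := by
        gcongr; exact abs_besselCoeff_le hν n
    _ = _ := by rw [mul_pow]; ring

/-- The function `₀F₁(; ν + 1; -t)`, the normalized Bessel function in the variable `t = x² / 4`. -/
def besselF (ν : ℝ) : ℝ → ℝ := powerSum (besselCoeff ν)

/-- The derivative of `besselF`. -/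
def besselF' (ν : ℝ) : ℝ → ℝ := powerSum (derivCoeff (besselCoeff ν))

/-- The normalized Dini function in the variable `t = x² / 4`. -/
def diniG (ν : ℝ) : ℝ → ℝ := powerSum fun n => (2 * (n : ℝ) + 1) * besselCoeff ν n

/-- The Euler derivative of `diniG`: the variable times the derivative. -/
def diniH (ν : ℝ) : ℝ → ℝ := powerSum fun n => (n : ℝ) * ((2 * (n : ℝ) + 1) * besselCoeff ν n)

section

variable {ν : ℝ}

lemma isEntire_diniCoeff (hν : -1 < ν) :
    IsEntire fun n => (2 * (n : ℝ) + 1) * besselCoeff ν n := by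
  have h := isEntire_besselCoeff hν
  convert (h.natCast_mul.const_mul 2).add h using 2
  ring

lemma hasDerivAt_besselF (hν : -1 < ν) (t : ℝ) :
    HasDerivAt (besselF ν) (besselF' ν t) t :=
  (isEntire_besselCoeff hν).hasDerivAt t

lemma besselF_zero (hν : -1 < ν) : besselF ν 0 = 1 := by
  rw [besselF, powerSum_zero, besselCoeff_zero hν]

/-- The Bessel equation `t f'' + (ν + 1) f' + f = 0`, read off from the coefficient recurrence. -/
lemma mul_powerSum_derivCoeff_derivCoeff (hν : -1 < ν) (t : ℝ) :
    t * powerSum (derivCoeff (derivCoeff (besselCoeff ν))) t =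
      -(ν + 1) * besselF' ν t - besselF ν t := by
  have h := isEntire_besselCoeff hν
  rw [mul_powerSum_derivCoeff h.derivCoeff, besselF, besselF', powerSum, powerSum, powerSum,
    ← tsum_mul_left, ← ((h.derivCoeff.summable t).mul_left _).tsum_sub (h.summable t)]
  refine tsum_congr fun n => ?_
  simp only [derivCoeff]
  linear_combination (t ^ n) * besselCoeff_succ hν n

lemma hasDerivAt_besselF' (hν : -1 < ν) {t : ℝ} (ht : t ≠ 0) :
    HasDerivAt (besselF' ν) ((-(ν + 1) * besselF' ν t - besselF ν t) / t) t := by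
  rw [← mul_powerSum_derivCoeff_derivCoeff hν, mul_div_cancel_left₀ _ ht]
  exact (isEntire_besselCoeff hν).derivCoeff.hasDerivAt t

lemma continuous_besselF (hν : -1 < ν) : Continuous (besselF ν) :=
  continuous_iff_continuousAt.2 fun t => ((isEntire_besselCoeff hν).hasDerivAt t).continuousAt

lemma continuous_besselF' (hν : -1 < ν) : Continuous (besselF' ν) :=
  continuous_iff_continuousAt.2 fun t =>
    ((isEntire_besselCoeff hν).derivCoeff.hasDerivAt t).continuousAt

lemma diniG_eq (hν : -1 < ν) (t : ℝ) : diniG ν t = besselF ν t + 2 * t * besselF' ν t := by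
  have h := isEntire_besselCoeff hν
  rw [mul_assoc, besselF', mul_powerSum_derivCoeff h, diniG, besselF, powerSum, powerSum,
    powerSum, ← tsum_mul_left, ← (h.summable t).tsum_add ((h.natCast_mul.summable t).mul_left 2)]
  exact tsum_congr fun n => by ring

lemma diniG_zero (hν : -1 < ν) : diniG ν 0 = 1 := by
  rw [diniG_eq hν, besselF_zero hν]; ring

lemma hasDerivAt_diniG (hν : -1 < ν) {t : ℝ} (ht : t ≠ 0) :
    HasDerivAt (diniG ν) (diniH ν t / t) t := by
  rw [diniH, ← mul_powerSum_derivCoeff (isEntire_diniCoeff hν), mul_div_cancel_left₀ _ ht]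
  exact (isEntire_diniCoeff hν).hasDerivAt t

lemma continuous_diniG (hν : -1 < ν) : Continuous (diniG ν) :=
  continuous_iff_continuousAt.2 fun t => ((isEntire_diniCoeff hν).hasDerivAt t).continuousAt

lemma continuous_diniH (hν : -1 < ν) : Continuous (diniH ν) :=
  continuous_iff_continuousAt.2 fun t =>
    ((isEntire_diniCoeff hν).natCast_mul.hasDerivAt t).continuousAt

/-- Differentiate `G = f + 2 t f'` and eliminate `f''` by the Bessel equation. -/
lemma diniH_eq (hν : -1 < ν) {t : ℝ} (ht : t ≠ 0) :
    diniH ν t = t * ((1 - 2 * ν) * besselF' ν t - 2 * besselF ν t) := by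
  have h1 := hasDerivAt_diniG hν ht
  have h2 := (hasDerivAt_besselF hν t).add
    (((hasDerivAt_id t).const_mul 2).mul (hasDerivAt_besselF' hν ht))
  have h3 : diniG ν = besselF ν + (fun t => 2 * id t) * besselF' ν := by
    funext s; simp [diniG_eq hν]
  rw [← h3] at h2
  have h4 := h1.unique h2
  simp only [id] at h4
  field_simp at h4
  linear_combination h4

end

/-! ### Changing the order by Beta averages. -/

section

open ProbabilityTheory

lemma ae_betaMeasure_mem_Ioo (α β : ℝ) : ∀ᵐ u ∂betaMeasure α β, u ∈ Ioo (0 : ℝ) 1 := by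
  have hm : Measurable (betaPDF α β) := (measurable_betaPDFReal α β).ennreal_ofReal
  rw [betaMeasure, ae_withDensity_iff hm]
  refine ae_of_all _ fun u hu => ?_
  by_contra h
  exact hu (by simp [betaPDF, betaPDFReal, show ¬ (0 < u ∧ u < 1) from h])

lemma lintegral_pow_betaMeasure {α β : ℝ} (hα : 0 < α) (hβ : 0 < β) (n : ℕ) :
    ∫⁻ u, ENNReal.ofReal (u ^ n) ∂betaMeasure α β =
      ENNReal.ofReal (beta (α + n) β / beta α β) := by
  have hm (a b : ℝ) : Measurable (betaPDF a b) := (measurable_betaPDFReal a b).ennreal_ofReal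
  rw [betaMeasure, lintegral_withDensity_eq_lintegral_mul _ (hm α β) (by fun_prop)]
  have hαn : 0 < α + n := by positivity
  have h1 := beta_pos hα hβ
  have h2 := beta_pos hαn hβ
  -- The factor `1` is written as the total mass of the Beta density with first parameter `α + n`;
  -- the two integrands then agree pointwise.
  rw [← mul_one (ENNReal.ofReal (beta (α + n) β / beta α β)), ← lintegral_betaPDF_eq_one hαn hβ,
    ← lintegral_const_mul _ (hm _ _)]
  refine lintegral_congr fun u => ?_
  simp only [Pi.mul_apply, betaPDF, betaPDFReal]
  split_ifs with hu
  · rw [← ENNReal.ofReal_mul' (pow_nonneg hu.1.le n), ← ENNReal.ofReal_mul (by positivity)]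
    congr 1
    rw [show α + n - 1 = (α - 1) + n by ring, Real.rpow_add_natCast hu.1.ne']
    field_simp
  · simp

lemma integrable_pow_betaMeasure {α β : ℝ} (hα : 0 < α) (hβ : 0 < β) (n : ℕ) :
    Integrable (fun u : ℝ => u ^ n) (betaMeasure α β) := by
  have := isProbabilityMeasureBeta hα hβ
  refine Integrable.of_bound (by fun_prop) 1 ?_
  filter_upwards [ae_betaMeasure_mem_Ioo α β] with u hu
  rw [norm_pow, Real.norm_of_nonneg hu.1.le]
  exact pow_le_one₀ hu.1.le hu.2.le

lemma integral_pow_betaMeasure {α β : ℝ} (hα : 0 < α) (hβ : 0 < β) (n : ℕ) :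
    ∫ u, u ^ n ∂betaMeasure α β = beta (α + n) β / beta α β := by
  rw [integral_eq_lintegral_of_nonneg_ae _ (by fun_prop), lintegral_pow_betaMeasure hα hβ,
    ENNReal.toReal_ofReal]
  · have hαn : 0 < α + n := by positivity
    exact (div_pos (beta_pos hαn hβ) (beta_pos hα hβ)).le
  · filter_upwards [ae_betaMeasure_mem_Ioo α β] with u hu
    exact pow_nonneg hu.1.le n

/-- The series form of Sonine's integral: the `n`-th Beta moment is exactly the ratio of the Gamma
factors. -/
lemma besselCoeff_eq_mul_integral {ν μ : ℝ} (hν : -1 < ν) (hμ : ν < μ) (n : ℕ) :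
    besselCoeff μ n = besselCoeff ν n * ∫ u, u ^ n ∂betaMeasure (ν + 1) (μ - ν) := by
  rw [integral_pow_betaMeasure (by linarith) (by linarith)]
  have hn := n.cast_nonneg (α := ℝ)
  have h1 := (Real.Gamma_pos_of_pos (show 0 < ν + 1 by linarith)).ne'
  have h2 := (Real.Gamma_pos_of_pos (show 0 < μ - ν by linarith)).ne'
  have h3 := (Real.Gamma_pos_of_pos (show 0 < μ + 1 by linarith)).ne'
  have h4 := (Real.Gamma_pos_of_pos (show 0 < n + ν + 1 by linarith)).ne'
  have h5 := (Real.Gamma_pos_of_pos (show 0 < n + μ + 1 by linarith)).ne'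
  rw [besselCoeff, besselCoeff, beta, beta, show ν + 1 + n = n + ν + 1 by ring,
    show (n : ℝ) + ν + 1 + (μ - ν) = n + μ + 1 by ring, show ν + 1 + (μ - ν) = μ + 1 by ring]
  field_simp

/-- Averaging a power series over dilations multiplies its coefficients by moments. -/
lemma integral_powerSum_betaMeasure {α β : ℝ} (hα : 0 < α) (hβ : 0 < β) {a : ℕ → ℝ}
    (ha : IsEntire a) (t : ℝ) :
    ∫ u, powerSum a (t * u) ∂betaMeasure α β =
      powerSum (fun n => a n * ∫ u, u ^ n ∂betaMeasure α β) t := by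
  have := isProbabilityMeasureBeta hα hβ
  have hint (n : ℕ) : Integrable (fun u : ℝ => a n * (t * u) ^ n) (betaMeasure α β) := by
    simp_rw [mul_pow, ← mul_assoc]
    exact (integrable_pow_betaMeasure hα hβ n).const_mul _
  have h := hasSum_integral_of_summable_integral_norm hint ?_
  · rw [powerSum]
    unfold powerSum
    rw [← h.tsum_eq]
    refine tsum_congr fun n => ?_
    simp_rw [mul_pow, integral_const_mul]
    ring
  · refine Summable.of_nonneg_of_le (fun n => integral_nonneg fun u => norm_nonneg _)
      (fun n => ?_) (ha |t| (abs_nonneg t))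
    have hb : ∫ u, ‖a n * (t * u) ^ n‖ ∂betaMeasure α β ≤
        ∫ _u, |a n| * |t| ^ n ∂betaMeasure α β := by
      refine integral_mono_ae (hint n).norm (integrable_const _) ?_
      filter_upwards [ae_betaMeasure_mem_Ioo α β] with u hu
      rw [norm_mul, norm_pow, norm_mul, Real.norm_eq_abs, Real.norm_eq_abs,
        Real.norm_of_nonneg hu.1.le]
      have := mul_le_of_le_one_right (abs_nonneg t) hu.2.le
      have := mul_nonneg (abs_nonneg t) hu.1.le
      gcongr
    simpa using hb

lemma diniG_eq_integral {ν μ : ℝ} (hν : -1 < ν) (hμ : ν < μ) (t : ℝ) :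
    diniG μ t = ∫ u, diniG ν (t * u) ∂betaMeasure (ν + 1) (μ - ν) := by
  unfold diniG
  rw [integral_powerSum_betaMeasure (by linarith) (by linarith) (isEntire_diniCoeff hν)]
  congr 1
  funext n
  rw [besselCoeff_eq_mul_integral hν hμ]
  ring

lemma diniH_eq_integral {ν μ : ℝ} (hν : -1 < ν) (hμ : ν < μ) (t : ℝ) :
    diniH μ t = ∫ u, diniH ν (t * u) ∂betaMeasure (ν + 1) (μ - ν) := by
  unfold diniH
  rw [integral_powerSum_betaMeasure (by linarith) (by linarith)
    (isEntire_diniCoeff hν).natCast_mul]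
  congr 1
  funext n
  rw [besselCoeff_eq_mul_integral hν hμ]
  ring

lemma integrable_comp_mul_betaMeasure {α β : ℝ} (hα : 0 < α) (hβ : 0 < β) {φ : ℝ → ℝ}
    (hφ : Continuous φ) (t : ℝ) : Integrable (fun u => φ (t * u)) (betaMeasure α β) := by
  have := isProbabilityMeasureBeta hα hβ
  have hc : Continuous fun u => φ (t * u) := by fun_prop
  obtain ⟨C, hC⟩ := isCompact_Icc.exists_bound_of_continuousOn (s := Icc (0 : ℝ) 1) hc.continuousOn
  refine Integrable.of_bound hc.aestronglyMeasurable C ?_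
  filter_upwards [ae_betaMeasure_mem_Ioo α β] with u hu
  exact hC u (Ioo_subset_Icc_self hu)

end

/-! ### Monotonicity in the variable for a fixed order. -/

lemma pos_of_hasDerivAt_pos {W W' : ℝ → ℝ} {T : ℝ} (hc : ContinuousOn W (Ico 0 T)) (h0 : W 0 = 0)
    (hd : ∀ t ∈ Ioo 0 T, HasDerivAt W (W' t) t) (hpos : ∀ t ∈ Ioo 0 T, 0 < W' t) {t : ℝ}
    (ht : t ∈ Ioo 0 T) : 0 < W t := by
  have hmono : StrictMonoOn W (Ico 0 T) := by
    refine strictMonoOn_of_deriv_pos (convex_Ico 0 T) hc fun s hs => ?_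
    rw [interior_Ico] at hs
    rw [(hd s hs).deriv]
    exact hpos s hs
  have := hmono (left_mem_Ico.2 (ht.1.trans ht.2)) (Ioo_subset_Ico_self ht) ht.1
  rwa [h0] at this

lemma monotoneOn_Ioo_of_hasDerivAt {W W' : ℝ → ℝ} {a b : ℝ}
    (hd : ∀ t ∈ Ioo a b, HasDerivAt W (W' t) t) (hpos : ∀ t ∈ Ioo a b, 0 ≤ W' t) :
    MonotoneOn W (Ioo a b) := by
  refine monotoneOn_of_deriv_nonneg (convex_Ioo a b)
    (fun t ht => (hd t ht).continuousAt.continuousWithinAt) ?_ ?_ <;> rw [interior_Ioo]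
  · exact fun t ht => (hd t ht).differentiableAt.differentiableWithinAt
  · intro t ht
    rw [(hd t ht).deriv]
    exact hpos t ht

/-- The square of `besselF` times the derivative of `besselP`. -/
def besselK (ν t : ℝ) : ℝ :=
  t * besselF' ν t ^ 2 + ν * (besselF ν t * besselF' ν t) + besselF ν t ^ 2

/-- The negative Euler logarithmic derivative of `besselF`. -/
def besselP (ν t : ℝ) : ℝ := -(t * besselF' ν t) / besselF ν t

/-- The function `f²` times the derivative of `t * besselK ν t / f²`, where `f = besselF ν`. -/
def besselS (ν t : ℝ) : ℝ := (2 * besselP ν t - ν) * besselK ν t + besselF ν t ^ 2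

section

variable {ν T : ℝ}

lemma hasDerivAt_besselK (hν : -1 < ν) {t : ℝ} (ht : t ≠ 0) :
    HasDerivAt (besselK ν) ((besselF ν t ^ 2 - (ν + 1) * besselK ν t) / t) t := by
  have hf := hasDerivAt_besselF hν t
  have hg := hasDerivAt_besselF' hν ht
  have h := (((hasDerivAt_id t).mul (hg.pow 2)).add ((hf.mul hg).const_mul ν)).add (hf.pow 2)
  refine HasDerivAt.congr_deriv h ?_
  simp only [besselK, id, Pi.pow_apply]
  field_simp
  ring

lemma hasDerivAt_besselP (hν : -1 < ν) {t : ℝ} (ht : t ≠ 0) (hft : besselF ν t ≠ 0) :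
    HasDerivAt (besselP ν) (besselK ν t / besselF ν t ^ 2) t := by
  have hf := hasDerivAt_besselF hν t
  have hg := hasDerivAt_besselF' hν ht
  have h := ((hasDerivAt_id t).mul hg).neg.div hf hft
  refine HasDerivAt.congr_deriv h ?_
  simp only [besselK, id, Pi.mul_apply, Pi.neg_apply]
  field_simp
  ring

lemma continuous_besselK (hν : -1 < ν) : Continuous (besselK ν) := by
  have h1 := continuous_besselF hν
  have h2 := continuous_besselF' hν
  unfold besselK
  fun_prop

lemma hasDerivAt_rpow_mul {φ : ℝ → ℝ} {φ' t : ℝ} (ht : 0 < t) (hφ : HasDerivAt φ φ' t) (ν : ℝ) :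
    HasDerivAt (fun t => t ^ (ν + 1) * φ t) (t ^ ν * ((ν + 1) * φ t + t * φ')) t := by
  have h := (Real.hasDerivAt_rpow_const (p := ν + 1) (Or.inl ht.ne')).mul hφ
  refine HasDerivAt.congr_deriv h ?_
  rw [add_sub_cancel_right, Real.rpow_add_one ht.ne']
  ring

/-- The integrating factor gives `(t ^ (ν + 1) * K)' = t ^ ν * f²`; the product vanishes at `0`
because `ν + 1 > 0`. -/
lemma besselK_pos (hν : -1 < ν) (hf : ∀ t ∈ Ico 0 T, 0 < besselF ν t) {t : ℝ}
    (ht : t ∈ Ioo 0 T) : 0 < besselK ν t := by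
  have hν' : 0 < ν + 1 := by linarith
  have h := pos_of_hasDerivAt_pos (W := fun t => t ^ (ν + 1) * besselK ν t)
    (W' := fun t => t ^ ν * besselF ν t ^ 2) (T := T) ?_ ?_ ?_ ?_ ht
  · exact pos_of_mul_pos_right h (Real.rpow_nonneg ht.1.le _)
  · exact ((Real.continuous_rpow_const hν'.le).mul (continuous_besselK hν)).continuousOn
  · simp [Real.zero_rpow hν'.ne']
  · intro s hs
    refine (hasDerivAt_rpow_mul hs.1 (hasDerivAt_besselK hν hs.1.ne') ν).congr_deriv ?_
    have := hs.1.ne'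
    field_simp
    ring
  · intro s hs
    have := hf s (Ioo_subset_Ico_self hs)
    have := hs.1
    positivity

/-- The same integrating factor gives `t ^ ν * (f² + 2 t K² / f²)`, again a visibly positive
derivative. -/
lemma besselS_pos (hν : -1 < ν) (hf : ∀ t ∈ Ico 0 T, 0 < besselF ν t) {t : ℝ}
    (ht : t ∈ Ioo 0 T) : 0 < besselS ν t := by
  have hν' : 0 < ν + 1 := by linarith
  have h1 := continuous_besselF hν
  have h2 := continuous_besselF' hν
  have h3 := continuous_besselK hν
  have h := pos_of_hasDerivAt_pos (W := fun t => t ^ (ν + 1) * besselS ν t)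
    (W' := fun t => t ^ ν * (besselF ν t ^ 2 + 2 * t * besselK ν t ^ 2 / besselF ν t ^ 2))
    (T := T) ?_ ?_ ?_ ?_ ht
  · exact pos_of_mul_pos_right h (Real.rpow_nonneg ht.1.le _)
  · have hP : ContinuousOn (besselP ν) (Ico 0 T) :=
      ContinuousOn.div (by fun_prop) (by fun_prop) fun s hs => (hf s hs).ne'
    refine (Real.continuous_rpow_const hν'.le).continuousOn.mul ?_
    unfold besselS
    fun_prop
  · simp [Real.zero_rpow hν'.ne']
  · intro s hs
    have hfs := (hf s (Ioo_subset_Ico_self hs)).ne'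
    have hs0 := hs.1.ne'
    have hP := hasDerivAt_besselP hν hs0 hfs
    have hS : HasDerivAt (besselS ν) _ s :=
      (((hP.const_mul 2).sub_const ν).mul (hasDerivAt_besselK hν hs0)).add
        ((hasDerivAt_besselF hν s).pow 2)
    refine (hasDerivAt_rpow_mul hs.1 hS ν).congr_deriv ?_
    simp only [besselS, besselP]
    field_simp
    ring
  · intro s hs
    have := hf s (Ioo_subset_Ico_self hs)
    have := hs.1
    positivity

/-- Positivity passes from `G` to `f` because `(√t f)' = G / (2 √t)`. -/
lemma besselF_pos (hν : -1 < ν) (hG : ∀ t ∈ Ico 0 T, 0 < diniG ν t) {t : ℝ}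
    (ht : t ∈ Ico 0 T) : 0 < besselF ν t := by
  rcases ht.1.eq_or_lt with rfl | ht0
  · simp [besselF_zero hν]
  have h := pos_of_hasDerivAt_pos (W := fun t => √t * besselF ν t)
    (W' := fun t => diniG ν t / (2 * √t)) (T := T) ?_ ?_ ?_ ?_ ⟨ht0, ht.2⟩
  · exact pos_of_mul_pos_right h (Real.sqrt_nonneg t)
  · exact (Real.continuous_sqrt.mul (continuous_besselF hν)).continuousOn
  · simp
  · intro s hs
    refine ((Real.hasDerivAt_sqrt hs.1.ne').mul (hasDerivAt_besselF hν s)).congr_deriv ?_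
    have h1 := Real.sqrt_pos.2 hs.1
    have h2 := Real.sq_sqrt hs.1.le
    rw [diniG_eq hν]
    field_simp
    rw [h2]
    ring
  · intro s hs
    have := hG s (Ioo_subset_Ico_self hs)
    have := Real.sqrt_pos.2 hs.1
    positivity

lemma diniG_eq_mul (hν : -1 < ν) {t : ℝ} (hft : besselF ν t ≠ 0) :
    diniG ν t = besselF ν t * (1 - 2 * besselP ν t) := by
  rw [diniG_eq hν, besselP]
  field_simp
  ring

lemma besselP_lt (hν : -1 < ν) (hG : ∀ t ∈ Ico 0 T, 0 < diniG ν t) {t : ℝ}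
    (ht : t ∈ Ico 0 T) : 0 < 1 - 2 * besselP ν t := by
  have hf := besselF_pos hν hG ht
  have h := hG t ht
  rw [diniG_eq_mul hν hf.ne'] at h
  exact pos_of_mul_pos_right h hf.le

lemma besselP_pos (hν : -1 < ν) (hG : ∀ t ∈ Ico 0 T, 0 < diniG ν t) {t : ℝ}
    (ht : t ∈ Ioo 0 T) : 0 < besselP ν t := by
  have hf := fun t ht => besselF_pos hν hG (t := t) ht
  have h1 := continuous_besselF hν
  have h2 := continuous_besselF' hν
  refine pos_of_hasDerivAt_pos (W' := fun t => besselK ν t / besselF ν t ^ 2)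
    (ContinuousOn.div (by fun_prop) (by fun_prop) fun s hs => (hf s hs).ne') (by simp)
    (fun s hs => hasDerivAt_besselP hν hs.1.ne' (hf s (Ioo_subset_Ico_self hs)).ne')
    (fun s hs => ?_) ht
  have := hf s (Ioo_subset_Ico_self hs)
  have := besselK_pos hν hf hs
  positivity

lemma monotoneOn_besselP (hν : -1 < ν) (hf : ∀ t ∈ Ico 0 T, 0 < besselF ν t) :
    MonotoneOn (besselP ν) (Ioo 0 T) := by
  refine monotoneOn_Ioo_of_hasDerivAt (fun s hs => hasDerivAt_besselP hν hs.1.ne'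
    (hf s (Ioo_subset_Ico_self hs)).ne') fun s hs => ?_
  have := hf s (Ioo_subset_Ico_self hs)
  have := besselK_pos hν hf hs
  positivity

lemma monotoneOn_mul_besselK_div (hν : -1 < ν) (hf : ∀ t ∈ Ico 0 T, 0 < besselF ν t) :
    MonotoneOn (fun t => t * besselK ν t / besselF ν t ^ 2) (Ioo 0 T) := by
  refine monotoneOn_Ioo_of_hasDerivAt (W' := fun t => besselS ν t / besselF ν t ^ 2)
    (fun s hs => ?_) fun s hs => ?_
  · have hfs := (hf s (Ioo_subset_Ico_self hs)).ne'
    have hs0 := hs.1.ne'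
    refine (((hasDerivAt_id s).mul (hasDerivAt_besselK hν hs0)).div
      ((hasDerivAt_besselF hν s).pow 2) (pow_ne_zero 2 hfs)).congr_deriv ?_
    simp only [besselS, besselP, id, Pi.mul_apply, Pi.pow_apply]
    field_simp
    ring
  · have := hf s (Ioo_subset_Ico_self hs)
    have := besselS_pos hν hf hs
    positivity

/-- Logarithmic differentiation of `G = f (1 - 2P)`, with `t P' = t K / f²`. -/
lemma neg_diniH_div_diniG (hν : -1 < ν) (hG : ∀ t ∈ Ico 0 T, 0 < diniG ν t) {t : ℝ}
    (ht : t ∈ Ioo 0 T) :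
    -diniH ν t / diniG ν t =
      besselP ν t + 2 * (t * besselK ν t / besselF ν t ^ 2) / (1 - 2 * besselP ν t) := by
  have ht' := Ioo_subset_Ico_self ht
  have hf := (besselF_pos hν hG ht').ne'
  have hP := (besselP_lt hν hG ht').ne'
  rw [diniG_eq_mul hν hf, div_eq_iff (mul_ne_zero hf hP), diniH_eq hν ht.1.ne', besselK]
  have hg : t * besselF' ν t = -(besselP ν t * besselF ν t) := by
    rw [besselP, div_mul_cancel₀ _ hf, neg_neg]
  field_simp
  linear_combination (-2 * t * besselF' ν t + 2 * besselP ν t * besselF ν t -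
    besselF ν t) * hg

lemma monotoneOn_neg_diniH_div_diniG (hν : -1 < ν) (hG : ∀ t ∈ Ico 0 T, 0 < diniG ν t) :
    MonotoneOn (fun t => -diniH ν t / diniG ν t) (Ioo 0 T) := by
  have hf := fun t ht => besselF_pos hν hG (t := t) ht
  intro s hs t ht hst
  simp only [neg_diniH_div_diniG hν hG hs, neg_diniH_div_diniG hν hG ht]
  have h1 := monotoneOn_besselP hν hf hs ht hst
  have h2 := monotoneOn_mul_besselK_div hν hf hs ht hst
  have h3 := besselP_lt hν hG (Ioo_subset_Ico_self ht)
  have h4 := besselK_pos hν hf ht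
  have h5 := hf t (Ioo_subset_Ico_self ht)
  have h6 := ht.1
  have h7 : 0 ≤ t * besselK ν t / besselF ν t ^ 2 := by positivity
  -- The denominator `1 - 2P` is positive and decreases, while the nonnegative numerator increases.
  gcongr

lemma diniH_nonpos (hν : -1 < ν) (hG : ∀ t ∈ Ico 0 T, 0 < diniG ν t) {t : ℝ}
    (ht : t ∈ Ioo 0 T) : diniH ν t ≤ 0 := by
  have ht' := Ioo_subset_Ico_self ht
  have hf := fun t ht => besselF_pos hν hG (t := t) ht
  have h := neg_diniH_div_diniG hν hG ht
  have h1 := besselP_pos hν hG ht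
  have h2 := besselK_pos hν hf ht
  have h3 := besselP_lt hν hG ht'
  have h4 := hf t ht'
  have h5 := ht.1
  have h6 := hG t ht'
  have h7 : 0 ≤ -diniH ν t / diniG ν t := by rw [h]; positivity
  rw [le_div_iff₀ h6] at h7
  linarith

lemma antitoneOn_diniG (hν : -1 < ν) (hG : ∀ t ∈ Ico 0 T, 0 < diniG ν t) :
    AntitoneOn (diniG ν) (Ico 0 T) := by
  refine antitoneOn_of_deriv_nonpos (convex_Ico 0 T) (continuous_diniG hν).continuousOn ?_ ?_ <;>
    rw [interior_Ico] <;> intro t ht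
  · exact (hasDerivAt_diniG hν ht.1.ne').differentiableAt.differentiableWithinAt
  · rw [(hasDerivAt_diniG hν ht.1.ne').deriv]
    exact div_nonpos_of_nonpos_of_nonneg (diniH_nonpos hν hG ht) ht.1.le

/-! ### Comparison of orders. -/

lemma mul_mem_Ico {t u : ℝ} (ht : t ∈ Ico 0 T) (hu : u ∈ Ioo (0 : ℝ) 1) : t * u ∈ Ico 0 T :=
  ⟨mul_nonneg ht.1 hu.1.le, (mul_le_of_le_one_right ht.1 hu.2.le).trans_lt ht.2⟩

open ProbabilityTheory

lemma diniG_le_diniG (hν : -1 < ν) (hG : ∀ t ∈ Ico 0 T, 0 < diniG ν t) {μ : ℝ} (hμ : ν ≤ μ)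
    {t : ℝ} (ht : t ∈ Ico 0 T) : diniG ν t ≤ diniG μ t := by
  rcases hμ.eq_or_lt with rfl | hμ
  · rfl
  have hα : 0 < ν + 1 := by linarith
  have hβ : 0 < μ - ν := by linarith
  have := isProbabilityMeasureBeta hα hβ
  rw [diniG_eq_integral hν hμ t]
  calc diniG ν t = ∫ _u, diniG ν t ∂betaMeasure (ν + 1) (μ - ν) := by simp
    _ ≤ _ := by
      refine integral_mono_ae (integrable_const _)
        (integrable_comp_mul_betaMeasure hα hβ (continuous_diniG hν) t) ?_
      filter_upwards [ae_betaMeasure_mem_Ioo (ν + 1) (μ - ν)] with u hu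
      exact antitoneOn_diniG hν hG (mul_mem_Ico ht hu) ht (mul_le_of_le_one_right ht.1 hu.2.le)

lemma diniG_pos_of_le (hν : -1 < ν) (hG : ∀ t ∈ Ico 0 T, 0 < diniG ν t) {μ : ℝ} (hμ : ν ≤ μ)
    {t : ℝ} (ht : t ∈ Ico 0 T) : 0 < diniG μ t :=
  (hG t ht).trans_le (diniG_le_diniG hν hG hμ ht)

/-- As `H/G` decreases, `H_ν(tu) ≥ (H_ν(t) / G_ν(t)) G_ν(tu)` for `0 < u < 1`; integrate over `u`.
-/
lemma diniH_div_diniG_le (hν : -1 < ν) (hG : ∀ t ∈ Ico 0 T, 0 < diniG ν t) {μ : ℝ} (hμ : ν ≤ μ)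
    {t : ℝ} (ht : t ∈ Ioo 0 T) : diniH ν t / diniG ν t ≤ diniH μ t / diniG μ t := by
  rcases hμ.eq_or_lt with rfl | hμ
  · rfl
  have hα : 0 < ν + 1 := by linarith
  have hβ : 0 < μ - ν := by linarith
  have ht' := Ioo_subset_Ico_self ht
  rw [le_div_iff₀ (diniG_pos_of_le hν hG hμ.le ht'), diniG_eq_integral hν hμ t,
    diniH_eq_integral hν hμ t, ← integral_const_mul]
  refine integral_mono_ae
    ((integrable_comp_mul_betaMeasure hα hβ (continuous_diniG hν) t).const_mul _)
    (integrable_comp_mul_betaMeasure hα hβ (continuous_diniH hν) t) ?_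
  filter_upwards [ae_betaMeasure_mem_Ioo (ν + 1) (μ - ν)] with u hu
  have hm := mul_mem_Ico ht' hu
  have h := monotoneOn_neg_diniH_div_diniG hν hG ⟨mul_pos ht.1 hu.1, hm.2⟩ ht
    (mul_le_of_le_one_right ht.1.le hu.2.le)
  simp only [neg_div, neg_le_neg_iff] at h
  rwa [← le_div_iff₀ (hG _ hm)]

/-- Without a zero, `G > 0` throughout, so `P < 1/2` on the half-line; but `P' ≥ 1/2` for large `t`,
which is absurd. -/
lemma exists_diniG_eq_zero (hν : -1 < ν) : ∃ t, 0 < t ∧ diniG ν t = 0 := by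
  by_contra! hne
  have hG : ∀ t, 0 ≤ t → 0 < diniG ν t := by
    intro t ht
    by_contra! hle
    obtain ⟨s, hs, hs0⟩ := intermediate_value_Icc' ht (continuous_diniG hν).continuousOn
      ⟨hle, by rw [diniG_zero hν]; exact zero_le_one⟩
    rcases hs.1.eq_or_lt with rfl | hs'
    · rw [diniG_zero hν] at hs0
      exact one_ne_zero hs0
    · exact hne s hs' hs0
  have hI (t : ℝ) (ht : 0 ≤ t) : t ∈ Ico 0 (t + 1) := ⟨ht, by linarith⟩
  have hf (t : ℝ) (ht : 0 ≤ t) : 0 < besselF ν t :=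
    besselF_pos hν (fun s hs => hG s hs.1) (hI t ht)
  have hP (t : ℝ) (ht : 0 ≤ t) : 0 < 1 - 2 * besselP ν t :=
    besselP_lt hν (fun s hs => hG s hs.1) (hI t ht)
  -- From `t ≥ ν² / 2` on, completing the square in `t (K - f² / 2)` leaves a nonnegative remainder
  -- `(t/2 - ν²/4) f²`; the `+ 1` keeps `a` positive.
  set a : ℝ := ν ^ 2 / 2 + 1 with ha
  have ha0 : 0 < a := by positivity
  have hd (t : ℝ) (ht : a ≤ t) : HasDerivAt (besselP ν) (besselK ν t / besselF ν t ^ 2) t :=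
    hasDerivAt_besselP hν (by linarith) (hf t (by linarith)).ne'
  have hlow (t : ℝ) (ht : a ≤ t) : 1 / 2 ≤ besselK ν t / besselF ν t ^ 2 := by
    rw [le_div_iff₀ (pow_pos (hf t (by linarith)) 2), besselK]
    have ht0 : 0 < t := by linarith
    have h1 : 0 ≤ t * (t * besselF' ν t ^ 2 + ν * (besselF ν t * besselF' ν t) +
        besselF ν t ^ 2 - 1 / 2 * besselF ν t ^ 2) := by
      have h2 : 0 ≤ (t / 2 - ν ^ 2 / 4) * besselF ν t ^ 2 :=
        mul_nonneg (by linarith) (sq_nonneg _)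
      linarith [sq_nonneg (t * besselF' ν t + ν / 2 * besselF ν t)]
    have := nonneg_of_mul_nonneg_right h1 ht0
    linarith
  -- Slope `1/2` over a length `1 - 2 P(a)` raises `P` from `P(a)` to at least `1/2`.
  set b := a + (1 - 2 * besselP ν a) with hb
  have hab : a ≤ b := by linarith [hP a ha0.le]
  have h := (convex_Ici a).mul_sub_le_image_sub_of_le_deriv (f := besselP ν) (C := 1 / 2)
    (fun t ht => (hd t ht).continuousAt.continuousWithinAt)
    (fun t ht => (hd t (interior_subset ht)).differentiableAt.differentiableWithinAt)
    (fun t ht => by rw [(hd t (interior_subset ht)).deriv]; exact hlow t (interior_subset ht))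
    a self_mem_Ici b hab hab
  linarith [hP b (by linarith)]

end

/-! ### Return to the variable `x`. -/

lemma hasDerivAt_rpow_mul_comp_sq {φ : ℝ → ℝ} {φ' x : ℝ} (hx : 0 < x)
    (hφ : HasDerivAt φ φ' (x ^ 2 / 4)) (ν c : ℝ) :
    HasDerivAt (fun x => (x / 2) ^ ν / c * φ (x ^ 2 / 4))
      ((x / 2) ^ ν / c * ((ν * φ (x ^ 2 / 4) + 2 * (x ^ 2 / 4 * φ')) / x)) x := by
  have h1 : HasDerivAt (fun x : ℝ => x ^ 2 / 4) (2 * x / 4) x := by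
    simpa using (hasDerivAt_pow 2 x).div_const 4
  have h2 : HasDerivAt (fun x : ℝ => (x / 2) ^ ν) (1 / 2 * ν * (x / 2) ^ (ν - 1)) x :=
    ((hasDerivAt_id x).div_const 2).rpow_const (Or.inl (by positivity))
  refine ((h2.div_const c).mul (hφ.comp x h1)).congr_deriv ?_
  rw [Real.rpow_sub_one (by positivity), Function.comp_apply]
  field_simp

section

variable {ν x : ℝ}

lemma besselJ_eq (hν : -1 < ν) (hx : 0 < x) :
    besselJ ν x = (x / 2) ^ ν / Real.Gamma (ν + 1) * besselF ν (x ^ 2 / 4) := by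
  have hΓ := (Real.Gamma_pos_of_pos (show 0 < ν + 1 by linarith)).ne'
  rw [besselJ, besselF, powerSum, ← tsum_mul_left]
  refine tsum_congr fun n => ?_
  have e : (x / 2) ^ (2 * (n : ℝ) + ν) = (x / 2) ^ ν * (x ^ 2 / 4) ^ n := by
    rw [add_comm, Real.rpow_add (by positivity), Real.rpow_mul (by positivity),
      Real.rpow_natCast, Real.rpow_two]
    ring
  rw [e, besselCoeff]
  field_simp

lemma dini_eq (hν : -1 < ν) (hx : 0 < x) :
    dini ν x = (x / 2) ^ ν / Real.Gamma (ν + 1) * diniG ν (x ^ 2 / 4) := by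
  have h := hasDerivAt_rpow_mul_comp_sq hx (hasDerivAt_besselF hν (x ^ 2 / 4)) ν
    (Real.Gamma (ν + 1))
  have he : besselJ ν =ᶠ[𝓝 x] fun x =>
      (x / 2) ^ ν / Real.Gamma (ν + 1) * besselF ν (x ^ 2 / 4) := by
    filter_upwards [Ioi_mem_nhds hx] with y hy using besselJ_eq hν hy
  rw [dini, (h.congr_of_eventuallyEq he).deriv, besselJ_eq hν hx, diniG_eq hν]
  field_simp
  ring

lemma hasDerivAt_dini (hν : -1 < ν) (hx : 0 < x) :
    HasDerivAt (dini ν) ((x / 2) ^ ν / Real.Gamma (ν + 1) *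
      ((ν * diniG ν (x ^ 2 / 4) + 2 * diniH ν (x ^ 2 / 4)) / x)) x := by
  have ht : x ^ 2 / 4 ≠ 0 := by positivity
  have h := hasDerivAt_rpow_mul_comp_sq hx (hasDerivAt_diniG hν ht) ν (Real.Gamma (ν + 1))
  rw [mul_div_cancel₀ _ ht] at h
  refine h.congr_of_eventuallyEq ?_
  filter_upwards [Ioi_mem_nhds hx] with y hy using dini_eq hν hy

lemma rpow_div_Gamma_pos (hν : -1 < ν) (hx : 0 < x) :
    0 < (x / 2) ^ ν / Real.Gamma (ν + 1) := by
  have := Real.Gamma_pos_of_pos (show 0 < ν + 1 by linarith)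
  positivity

lemma dini_eq_zero_iff (hν : -1 < ν) (hx : 0 < x) :
    dini ν x = 0 ↔ diniG ν (x ^ 2 / 4) = 0 := by
  rw [dini_eq hν hx, mul_eq_zero, or_iff_right (rpow_div_Gamma_pos hν hx).ne']

lemma normalized_dini_eq (hν : -1 < ν) (hx : 0 < x) :
    (2 : ℝ) ^ ν * Real.Gamma (ν + 1) * x ^ (-ν) * dini ν x = diniG ν (x ^ 2 / 4) := by
  have h1 := Real.Gamma_pos_of_pos (show 0 < ν + 1 by linarith)
  have h2 := Real.rpow_pos_of_pos hx ν
  rw [dini_eq hν hx, Real.div_rpow hx.le zero_le_two, Real.rpow_neg hx.le]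
  field_simp

lemma mul_deriv_dini_div_dini (hν : -1 < ν) (hx : 0 < x) (hG : diniG ν (x ^ 2 / 4) ≠ 0) :
    x * deriv (dini ν) x / dini ν x =
      ν + 2 * (diniH ν (x ^ 2 / 4) / diniG ν (x ^ 2 / 4)) := by
  have h1 := (Real.Gamma_pos_of_pos (show 0 < ν + 1 by linarith)).ne'
  have h2 := (Real.rpow_pos_of_pos (show 0 < x / 2 by positivity) ν).ne'
  rw [(hasDerivAt_dini hν hx).deriv, dini_eq hν hx]
  field_simp

lemma isLeast_diniZero (hν : -1 < ν) :
    IsLeast {x : ℝ | 0 < x ∧ dini ν x = 0} (diniZero ν) := by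
  have hbdd : BddBelow {x : ℝ | 0 < x ∧ dini ν x = 0} := ⟨0, fun x hx => hx.1.le⟩
  -- Since `G(0) = 1`, allowing `x = 0` adds no zero; this makes the set closed, so its infimum is
  -- attained.
  have he : {x : ℝ | 0 < x ∧ dini ν x = 0} = Ici 0 ∩ {x | diniG ν (x ^ 2 / 4) = 0} := by
    ext x
    refine ⟨fun h => ⟨h.1.le, (dini_eq_zero_iff hν h.1).1 h.2⟩, fun h => ?_⟩
    have hx : 0 < x := by
      refine lt_of_le_of_ne h.1 fun h0 => ?_
      have h1 := h.2
      simp [← h0, diniG_zero hν] at h1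
    exact ⟨hx, (dini_eq_zero_iff hν hx).2 h.2⟩
  have hclosed : IsClosed {x : ℝ | 0 < x ∧ dini ν x = 0} := by
    rw [he]
    have := continuous_diniG hν
    exact isClosed_Ici.inter (isClosed_eq (by fun_prop) continuous_const)
  have hne : {x : ℝ | 0 < x ∧ dini ν x = 0}.Nonempty := by
    obtain ⟨t, ht, ht0⟩ := exists_diniG_eq_zero hν
    have hpos : 0 < 2 * √t := by positivity
    refine ⟨2 * √t, hpos, (dini_eq_zero_iff hν hpos).2 ?_⟩
    rwa [mul_pow, Real.sq_sqrt ht.le, show (2 : ℝ) ^ 2 * t / 4 = t by ring]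
  exact ⟨hclosed.csInf_mem hne hbdd, fun x hx => csInf_le hbdd hx⟩

lemma diniG_pos_of_lt_diniZero (hν : -1 < ν) :
    ∀ t ∈ Ico 0 (diniZero ν ^ 2 / 4), 0 < diniG ν t := by
  intro t ht
  by_contra! hle
  obtain ⟨s, hs, hs0⟩ := intermediate_value_Icc' ht.1 (continuous_diniG hν).continuousOn
    ⟨hle, by rw [diniG_zero hν]; exact zero_le_one⟩
  have hs' : 0 < s := by
    refine lt_of_le_of_ne hs.1 fun h => ?_
    rw [← h, diniG_zero hν] at hs0
    exact one_ne_zero hs0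
  have hpos : 0 < 2 * √s := by positivity
  have hle := (isLeast_diniZero hν).2 ⟨hpos, (dini_eq_zero_iff hν hpos).2 (by
    rwa [mul_pow, Real.sq_sqrt hs'.le, show (2 : ℝ) ^ 2 * s / 4 = s by ring])⟩
  have h1 := pow_le_pow_left₀ (isLeast_diniZero hν).1.1.le hle 2
  rw [mul_pow, Real.sq_sqrt hs'.le] at h1
  linarith [ht.2, hs.2]

lemma sq_div_four_mem_Ioo {a : ℝ} (hx : x ∈ Ioo 0 a) : x ^ 2 / 4 ∈ Ioo 0 (a ^ 2 / 4) := by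
  have h1 := hx.1
  have h2 := hx.2
  exact ⟨by positivity, by gcongr⟩

lemma dini_pos_of_mem_Ioo (hν : -1 < ν) {μ : ℝ} (hμ : ν ≤ μ) (hx : x ∈ Ioo 0 (diniZero ν)) :
    0 < dini μ x := by
  rw [dini_eq (hν.trans_le hμ) hx.1]
  exact mul_pos (rpow_div_Gamma_pos (hν.trans_le hμ) hx.1) (diniG_pos_of_le hν
    (diniG_pos_of_lt_diniZero hν) hμ (Ioo_subset_Ico_self (sq_div_four_mem_Ioo hx)))

lemma monotoneOn_normalized_dini (hν : -1 < ν) (hx : x ∈ Ioo 0 (diniZero ν)) :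
    MonotoneOn (fun μ : ℝ => (2 : ℝ) ^ μ * Real.Gamma (μ + 1) * x ^ (-μ) * dini μ x)
      (Ici ν) := by
  intro μ hμ ρ hρ h
  rw [mem_Ici] at hμ hρ
  simp only [normalized_dini_eq (hν.trans_le hμ) hx.1, normalized_dini_eq (hν.trans_le hρ) hx.1]
  -- The base order is now `μ`, but the interval is still the one given by the first zero of order
  -- `ν`, where `G_μ` is positive too.
  exact diniG_le_diniG (hν.trans_le hμ)
    (fun t ht => diniG_pos_of_le hν (diniG_pos_of_lt_diniZero hν) hμ ht) h
    (Ioo_subset_Ico_self (sq_div_four_mem_Ioo hx))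

lemma monotoneOn_mul_deriv_dini_div_dini (hν : -1 < ν) (hx : x ∈ Ioo 0 (diniZero ν)) :
    MonotoneOn (fun μ : ℝ => x * deriv (dini μ) x / dini μ x) (Ici ν) := by
  intro μ hμ ρ hρ h
  rw [mem_Ici] at hμ hρ
  have ht := sq_div_four_mem_Ioo hx
  have hG {κ : ℝ} (hκ : ν ≤ κ) : ∀ t ∈ Ico 0 (diniZero ν ^ 2 / 4), 0 < diniG κ t :=
    fun t ht => diniG_pos_of_le hν (diniG_pos_of_lt_diniZero hν) hκ ht
  simp only [mul_deriv_dini_div_dini (hν.trans_le hμ) hx.1 (hG hμ _ (Ioo_subset_Ico_self ht)).ne',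
    mul_deriv_dini_div_dini (hν.trans_le hρ) hx.1 (hG hρ _ (Ioo_subset_Ico_self ht)).ne']
  have := diniH_div_diniG_le (hν.trans_le hμ) (hG hμ) h ht
  linarith

lemma deriv_dini_div_dini_le (hν : -1 < ν) {μ : ℝ} (hμ : ν ≤ μ) (hx : x ∈ Ioo 0 (diniZero ν)) :
    deriv (dini ν) x / dini ν x ≤ deriv (dini μ) x / dini μ x := by
  have h := monotoneOn_mul_deriv_dini_div_dini hν hx self_mem_Ici hμ hμ
  simp only [mul_div_assoc] at h
  exact le_of_mul_le_mul_left h hx.1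

lemma le_rpow_mul_dini_div_dini (hν : -1 < ν) {μ : ℝ} (hμ : ν ≤ μ)
    (hx : x ∈ Ioo 0 (diniZero ν)) :
    (2 : ℝ) ^ (ν - μ) * (Real.Gamma (ν + 1) / Real.Gamma (μ + 1)) ≤
      x ^ (ν - μ) * (dini μ x / dini ν x) := by
  have h := monotoneOn_normalized_dini hν hx self_mem_Ici hμ hμ
  have h1 := dini_pos_of_mem_Ioo hν le_rfl hx
  have h2 := Real.Gamma_pos_of_pos (show 0 < μ + 1 by linarith)
  have h3 := Real.rpow_pos_of_pos hx.1 ν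
  have h4 := Real.rpow_pos_of_pos hx.1 μ
  have h5 := Real.rpow_pos_of_pos (zero_lt_two (α := ℝ)) ν
  have h6 := Real.rpow_pos_of_pos (zero_lt_two (α := ℝ)) μ
  simp only [Real.rpow_neg hx.1.le] at h
  rw [Real.rpow_sub hx.1, Real.rpow_sub zero_lt_two, div_mul_div_comm, div_mul_div_comm,
    div_le_div_iff₀ (by positivity) (by positivity)]
  have h7 := mul_le_mul_of_nonneg_right h (mul_pos h3 h4).le
  field_simp at h7
  linarith

/-- The quotient of two positive functions increases when the numerator has the larger logarithmic
derivative. -/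
lemma monotoneOn_dini_div_dini (hν : -1 < ν) {μ : ℝ} (hμ : ν ≤ μ) :
    MonotoneOn (fun x : ℝ => dini μ x / dini ν x) (Ioo 0 (diniZero ν)) := by
  have hd {κ : ℝ} (hκ : ν ≤ κ) {x : ℝ} (hx : x ∈ Ioo 0 (diniZero ν)) :
      HasDerivAt (dini κ) (deriv (dini κ) x) x :=
    (hasDerivAt_dini (hν.trans_le hκ) hx.1).differentiableAt.hasDerivAt
  refine monotoneOn_Ioo_of_hasDerivAt
    (fun x hx => (hd hμ hx).div (hd le_rfl hx) (dini_pos_of_mem_Ioo hν le_rfl hx).ne')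
    fun x hx => ?_
  have h := deriv_dini_div_dini_le hν hμ hx
  rw [div_le_div_iff₀ (dini_pos_of_mem_Ioo hν le_rfl hx) (dini_pos_of_mem_Ioo hν hμ hx)] at h
  exact div_nonneg (by linarith) (sq_nonneg _)

end

end

theorem theorem6 (ν : ℝ) (hν : -1 < ν) :
    IsLeast {x : ℝ | 0 < x ∧ dini ν x = 0} (diniZero ν) ∧
    (∀ x ∈ Set.Ioo 0 (diniZero ν),
      (∀ μ : ℝ, ν ≤ μ → 0 < dini μ x) ∧
      MonotoneOn (fun μ : ℝ => (2 : ℝ) ^ μ * Real.Gamma (μ + 1) * x ^ (-μ) * dini μ x)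
        (Set.Ici ν) ∧
      MonotoneOn (fun μ : ℝ => x * deriv (dini μ) x / dini μ x) (Set.Ici ν) ∧
      (∀ μ : ℝ, ν ≤ μ →
        (2 : ℝ) ^ (ν - μ) * (Real.Gamma (ν + 1) / Real.Gamma (μ + 1)) ≤
            x ^ (ν - μ) * (dini μ x / dini ν x) ∧
          deriv (dini ν) x / dini ν x ≤ deriv (dini μ) x / dini μ x)) ∧
    (∀ μ : ℝ, ν ≤ μ →
      MonotoneOn (fun x : ℝ => dini μ x / dini ν x) (Set.Ioo 0 (diniZero ν))) := by
  refine ⟨isLeast_diniZero hν, fun x hx => ⟨fun μ hμ => dini_pos_of_mem_Ioo hν hμ hx,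
    monotoneOn_normalized_dini hν hx, monotoneOn_mul_deriv_dini_div_dini hν hx,
    fun μ hμ => ⟨le_rpow_mul_dini_div_dini hν hμ hx, deriv_dini_div_dini_le hν hμ hx⟩⟩,
    fun μ hμ => monotoneOn_dini_div_dini hν hμ⟩
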